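/- Let $d\ge 1$, let $(S,\mathcal S)$ be a standard Borel space with a $\sigma$-finite measure $\mu$, and let $\{\phi_t\}_{t\in\mathbb Z^d}$ be a nonsingular $\mathbb Z^d$-action on $(S,\mathcal S,\mu)$: the maps $\phi_t:S\to S$ are measurable, $\phi_0=\mathrm{id}$, $\phi_{t+u}=\phi_t\circ\phi_u$, and $\mu\circ\phi_t\sim\mu$ for all $t,u\in\mathbb Z^d$, where $(\mu\circ\phi_t)(A)=\mu(\phi_t(A))$. Let $\mathrm{Leb}$ be Lebesgue measure on $(0,\infty)$ with its Borel $\sigma$-algebra $\mathcal B$, and for $t\in\mathbb Z^d$ define the Maharam skew product $$\phi^*_t(s,y)=\Bigl(\phi_t(s),\; y\,\frac{d\mu}{d(\mu\circ\phi_t)}(s)\Bigr),\qquad (s,y)\in S\times(0,\infty),$$ where for each $t$ a $(0,\infty)$-valued measurable version of the Radon–Nikodym derivative is chosen. A family $\{\psi_t\}_{t\in\mathbb Z^d}$ of measurable maps on a measure space $(X,\mathcal X,\nu)$ is called conservative if it has no wandering set of positive measure, that is, if $\nu(W)=0$ for every $W\in\mathcal X$ such that $\nu(\psi_t^{-1}(W)\cap\psi_u^{-1}(W))=0$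 for all $t\ne u$ in $\mathbb Z^d$. Then $\{\phi^*_t\}_{t\in\mathbb Z^d}$ is conservative on $\bigl(S\times(0,\infty),\mathcal S\times\mathcal B,\mu\times\mathrm{Leb}\bigr)$ if and only if $\{\phi_t\}_{t\in\mathbb Z^d}$ is conservative on $(S,\mathcal S,\mu)$. -/

import Mathlib

open MeasureTheory

/-- A pointwise action `φ` of the additive group `G` on `S` by measurable maps that is nonsingular:
each `φ t` is measurable and pulls `μ`-null sets back to `μ`-null sets. Applied to `t` and `-t`
this says `μ ∘ φ t ∼ μ` for every `t`. -/
structure IsNonsingularAction {G S : Type*} [AddGroup G] [MeasurableSpace S]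
    (φ : G → S → S) (μ : Measure S) : Prop where
  zero_apply : ∀ s, φ 0 s = s
  add_apply : ∀ t u s, φ (t + u) s = φ t (φ u s)
  quasiMeasurePreserving : ∀ t, Measure.QuasiMeasurePreserving (φ t) μ μ

/-- `W` is a wandering set for the family `φ`: its preimages under the `φ t` are pairwise disjoint
modulo `μ`. For an action of a group the preimages are the translates of `W`. Working modulo null
sets makes the notion insensitive to changing each `φ t` on a null set; for a pointwise nonsingular
action of a countable group, every such `W` differs by a null set from a measurable set whose
translates are genuinely disjoint. -/
def IsWanderingSet {G X : Type*} [MeasurableSpace X] (φ : G → X → X) (μ : Measure X)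
    (W : Set X) : Prop :=
  MeasurableSet W ∧ Pairwise fun t u => AEDisjoint μ (φ t ⁻¹' W) (φ u ⁻¹' W)

/-- The family `φ` is conservative: there is no wandering set of positive measure. -/
def IsConservativeAction {G X : Type*} [MeasurableSpace X] (φ : G → X → X)
    (μ : Measure X) : Prop :=
  ∀ W : Set X, IsWanderingSet φ μ W → μ W = 0

/-- The Radon-Nikodym derivative `dμ / d(μ ∘ f)` as a function with values in `(0, ∞)`, where
`μ ∘ f` is the measure `A ↦ μ (f '' A)`. For a nonsingular automorphism `f` of a `σ`-finite space
the derivative lies in `(0, ∞)` almost everywhere; on the remaining null set the value `1` is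
used. -/
noncomputable def maharamDensity {S : Type*} [MeasurableSpace S] (f : S → S) (μ : Measure S)
    (s : S) : {y : ℝ // 0 < y} :=
  open Classical in
  if h : 0 < (μ.rnDeriv (μ.comap f) s).toReal then ⟨(μ.rnDeriv (μ.comap f) s).toReal, h⟩ else 1

/-- Lebesgue measure on `(0, ∞)`. -/
noncomputable def lebesguePos : Measure {y : ℝ // 0 < y} :=
  Measure.comap Subtype.val (volume : Measure ℝ)

/-- The Maharam skew product `φ*_t (s, y) = (φ_t s, y * dμ/d(μ ∘ φ_t) (s))` on `S × (0, ∞)`. -/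
noncomputable def maharamSkewProduct {G S : Type*} [MeasurableSpace S] (φ : G → S → S)
    (μ : Measure S) (t : G) (p : S × {y : ℝ // 0 < y}) : S × {y : ℝ // 0 < y} :=
  (φ t p.1, p.2 * maharamDensity (φ t) μ p.1)

/-!
The Maharam skew product `φ*` preserves the measure `ν = μ × Leb`, by the change of variables
formula for `φ t` on the base and the scaling of Lebesgue measure on the fibres
(`IsNonsingularAction.measurePreserving_maharamSkewProduct`).

If `W` is wandering for `φ`, the cylinder `W × (0, ∞)` is wandering for `φ*`, and it has positive
measure if `W` does. So conservativity passes from `φ*` to `φ`.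

For the converse, let `W` be wandering for `φ*` and let `h` be a positive `μ`-integrable function.
As `φ*` preserves `ν`, almost every point of `W` visits a given set of finite measure only finitely
often (`IsNonsingularAction.ae_finite_visits_of_isWanderingSet`). Applied to the regions
`{(s, y) | y < a * h s}`, this says that for almost every `(s, y)` in `W` the weights
`orbitWeight φ μ h t s = h (φ t s) * d(μ ∘ φ t)/dμ (s)` exceed any given positive level for only
finitely many `t`. Hence they attain their maximum over `t`, at a finite set of times, and this set
has a least element for the lexicographic order of `ℤ^d`. By the cocycle identity
(`IsNonsingularAction.maharamDensity_add`), moving along the orbit only rescales the weights and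
translates the time; since the order is translation invariant, almost every orbit meets the set of
points whose first maximum is at time `0` at most once. That set is therefore wandering for `φ`
(`IsNonsingularAction.isWanderingSet_firstMaximumSet`). If `φ` is conservative, it is a null set,
almost no orbit meets it, and so `ν W = 0`.
-/

open Set
open scoped ENNReal

/-! ### Weights along an orbit and their first maximum -/

theorem exists_first_maximum {G : Type*} [LinearOrder G] {v : G → ℝ} {t₀ : G}
    (hfin : {t | v t₀ ≤ v t}.Finite) :
    ∃ t, ∀ r, v r ≤ v t ∧ (v r = v t → t ≤ r) := by
  obtain ⟨m, hm, hmax⟩ := hfin.exists_maximalFor v _ ⟨t₀, le_refl (v t₀)⟩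
  have hle (r : G) : v r ≤ v m := by
    by_contra! hr
    exact hr.not_ge (hmax (show v t₀ ≤ v r from hm.trans hr.le) hr.le)
  have hfin' : {t | v t = v m}.Finite := hfin.subset fun t ht => hm.trans_eq (Eq.symm ht)
  obtain ⟨t, ht, hmin⟩ := hfin'.exists_minimalFor id _ ⟨m, rfl⟩
  have ht : v t = v m := ht
  refine ⟨t, fun r => ⟨ht ▸ hle r, fun hr => ?_⟩⟩
  exact (le_total t r).elim id fun hrt => hmin (hr.trans ht) hrt

/-- The density of `(h μ) ∘ φ t` with respect to `μ`, where `h μ` has density `h` with respect to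
`μ`. A positive `μ`-integrable `h` makes `h μ` a finite measure equivalent to `μ`. -/
noncomputable def orbitWeight {G S : Type*} [MeasurableSpace S] (φ : G → S → S) (μ : Measure S)
    (h : S → ℝ) (t : G) (s : S) : ℝ :=
  h (φ t s) / maharamDensity (φ t) μ s

/-- The points at which the weight along the orbit attains its maximum at time `0`, and at no
earlier time. -/
def firstMaximumSet {G S : Type*} [MeasurableSpace S] [Zero G] [LE G] (φ : G → S → S)
    (μ : Measure S) (h : S → ℝ) : Set S :=
  {s | ∀ t, orbitWeight φ μ h t s ≤ orbitWeight φ μ h 0 s ∧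
    (orbitWeight φ μ h t s = orbitWeight φ μ h 0 s → 0 ≤ t)}

/-! ### Lebesgue measure on `(0, ∞)` and measurability of the density -/

theorem measurable_maharamDensity {S : Type*} [MeasurableSpace S] (f : S → S) (μ : Measure S) :
    Measurable (maharamDensity f μ) := by
  classical
  have hm : Measurable fun s => (μ.rnDeriv (μ.comap f) s).toReal :=
    (Measure.measurable_rnDeriv _ _).ennreal_toReal
  refine Measurable.subtype_mk (f := fun s => ((maharamDensity f μ s : {y : ℝ // 0 < y}) : ℝ)) ?_
  have h : (fun s => ((maharamDensity f μ s : {y : ℝ // 0 < y}) : ℝ)) =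
      fun s => if 0 < (μ.rnDeriv (μ.comap f) s).toReal then
        (μ.rnDeriv (μ.comap f) s).toReal else 1 := by
    ext s
    unfold maharamDensity
    split_ifs <;> rfl
  rw [h]
  exact Measurable.ite (measurableSet_lt measurable_const hm) hm measurable_const

theorem measurableEmbedding_val_pos :
    MeasurableEmbedding (Subtype.val : {y : ℝ // 0 < y} → ℝ) :=
  MeasurableEmbedding.subtype_coe measurableSet_Ioi

theorem measurable_mul_pos {X : Type*} [MeasurableSpace X] {f g : X → {y : ℝ // 0 < y}}
    (hf : Measurable f) (hg : Measurable g) : Measurable fun x => f x * g x :=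
  Measurable.subtype_mk (f := fun x => (f x : ℝ) * (g x : ℝ))
    (hf.subtype_val.mul hg.subtype_val)

theorem lebesguePos_apply (E : Set {y : ℝ // 0 < y}) :
    lebesguePos E = volume (Subtype.val '' E) :=
  measurableEmbedding_val_pos.comap_apply _ _

theorem lebesguePos_setOf_lt (a : ℝ) :
    lebesguePos {y | (y : ℝ) < a} = ENNReal.ofReal a := by
  have h : Subtype.val '' {y : {y : ℝ // 0 < y} | (y : ℝ) < a} = Ioo 0 a := by
    ext x
    simp [and_comm]
  rw [lebesguePos_apply, h, Real.volume_Ioo, sub_zero]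

instance sigmaFinite_lebesguePos : SigmaFinite lebesguePos := by
  refine ⟨⟨⟨fun n : ℕ => {y | (y : ℝ) < n}, fun _ => trivial, fun n => ?_, ?_⟩⟩⟩
  · rw [lebesguePos_setOf_lt]
    exact ENNReal.ofReal_lt_top
  · exact eq_univ_of_forall fun y => mem_iUnion.2 (exists_nat_gt (y : ℝ))

theorem lebesguePos_univ_ne_zero : lebesguePos univ ≠ 0 := by
  intro h
  have := measure_mono_null (subset_univ {y : {y : ℝ // 0 < y} | (y : ℝ) < 1}) h
  rw [lebesguePos_setOf_lt] at this
  simp at this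

theorem lebesguePos_preimage_mul_right (c : {y : ℝ // 0 < y}) (E : Set {y : ℝ // 0 < y}) :
    lebesguePos ((· * c) ⁻¹' E) = ENNReal.ofReal (c : ℝ)⁻¹ * lebesguePos E := by
  have h : Subtype.val '' ((· * c) ⁻¹' E) = (· * (c : ℝ)) ⁻¹' (Subtype.val '' E) := by
    ext x
    constructor
    · rintro ⟨y, hy, rfl⟩
      exact ⟨y * c, hy, rfl⟩
    · rintro ⟨z, hz, hzx⟩
      have hx : 0 < x := by
        have hz0 : 0 < x * (c : ℝ) := z.2.trans_eq hzx
        exact pos_of_mul_pos_left hz0 c.2.le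
      refine ⟨⟨x, hx⟩, ?_, rfl⟩
      have : (⟨x, hx⟩ * c : {y : ℝ // 0 < y}) = z := Subtype.ext hzx.symm
      rwa [mem_preimage, this]
  rw [lebesguePos_apply, lebesguePos_apply, h, Real.volume_preimage_mul_right c.2.ne',
    abs_of_pos (inv_pos.2 c.2)]

theorem prod_lebesguePos_setOf_lt {S : Type*} [MeasurableSpace S] {μ : Measure S} [SigmaFinite μ]
    {h : S → ℝ} (hh : Measurable h) :
    μ.prod lebesguePos {p | (p.2 : ℝ) < h p.1} = ∫⁻ s, ENNReal.ofReal (h s) ∂μ := by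
  have hm : MeasurableSet {p : S × {y : ℝ // 0 < y} | (p.2 : ℝ) < h p.1} :=
    measurableSet_lt measurable_snd.subtype_val (hh.comp measurable_fst)
  rw [Measure.prod_apply hm]
  exact lintegral_congr fun s => lebesguePos_setOf_lt (h s)

/-! ### Radon-Nikodym derivatives along a nonsingular action -/

/-- Change of variables along a nonsingular automorphism: `1 / maharamDensity e μ` is the
density of `μ ∘ e` with respect to `μ`. -/
theorem lintegral_comp_mul_inv_maharamDensity {S : Type*} [MeasurableSpace S] {μ : Measure S}
    [SigmaFinite μ] (e : S ≃ᵐ S) (he : Measure.QuasiMeasurePreserving e μ μ)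
    (he' : Measure.QuasiMeasurePreserving e.symm μ μ) {f : S → ℝ≥0∞} (hf : Measurable f) :
    ∫⁻ s, ENNReal.ofReal (maharamDensity e μ s : ℝ)⁻¹ * f (e s) ∂μ = ∫⁻ s, f s ∂μ := by
  have hmap : μ.comap e = μ.map e.symm := e.map_symm.symm
  have : SigmaFinite (μ.comap e) := hmap ▸ e.symm.sigmaFinite_map
  have hac : μ.comap e ≪ μ := hmap ▸ he'.absolutelyContinuous
  have hac' : μ ≪ μ.comap e := by
    intro A hA
    rw [e.measurableEmbedding.comap_apply] at hA
    have := he.preimage_null hA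
    rwa [preimage_image_eq _ e.injective] at this
  have hdens : (fun s => ENNReal.ofReal (maharamDensity e μ s : ℝ)⁻¹) =ᵐ[μ]
      (μ.comap e).rnDeriv μ := by
    filter_upwards [Measure.inv_rnDeriv hac', Measure.rnDeriv_pos hac',
      hac'.ae_le (Measure.rnDeriv_lt_top μ (μ.comap e))] with s hs hpos htop
    have hpos := ENNReal.toReal_pos hpos.ne' htop.ne
    rw [← hs, maharamDensity, dif_pos hpos, ENNReal.ofReal_inv_of_pos hpos,
      ENNReal.ofReal_toReal htop.ne, Pi.inv_apply]
  calc ∫⁻ s, ENNReal.ofReal (maharamDensity e μ s : ℝ)⁻¹ * f (e s) ∂μ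
      = ∫⁻ s, (μ.comap e).rnDeriv μ s * f (e s) ∂μ :=
        lintegral_congr_ae (hdens.mul (Filter.EventuallyEq.refl _ _))
    _ = ∫⁻ s, f (e s) ∂μ.withDensity ((μ.comap e).rnDeriv μ) :=
        (lintegral_withDensity_eq_lintegral_mul μ (Measure.measurable_rnDeriv _ _)
          (hf.comp e.measurable)).symm
    _ = ∫⁻ s, f s ∂μ := by
        rw [Measure.withDensity_rnDeriv_eq _ _ hac, hmap,
          lintegral_map_equiv]
        simp

namespace IsNonsingularAction

variable {G S : Type*} [MeasurableSpace S] {φ : G → S → S} {μ : Measure S}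

theorem neg_apply_apply [AddGroup G] (hφ : IsNonsingularAction φ μ) (t : G) (s : S) :
    φ (-t) (φ t s) = s := by
  rw [← hφ.add_apply, neg_add_cancel, hφ.zero_apply]

theorem apply_neg_apply [AddGroup G] (hφ : IsNonsingularAction φ μ) (t : G) (s : S) :
    φ t (φ (-t) s) = s := by
  rw [← hφ.add_apply, add_neg_cancel, hφ.zero_apply]

theorem measurable [AddGroup G] (hφ : IsNonsingularAction φ μ) (t : G) : Measurable (φ t) :=
  (hφ.quasiMeasurePreserving t).measurable

theorem lintegral_comp_mul [AddGroup G] [SigmaFinite μ] (hφ : IsNonsingularAction φ μ) (t : G)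
    {f : S → ℝ≥0∞} (hf : Measurable f) :
    ∫⁻ s, ENNReal.ofReal (maharamDensity (φ t) μ s : ℝ)⁻¹ * f (φ t s) ∂μ = ∫⁻ s, f s ∂μ :=
  lintegral_comp_mul_inv_maharamDensity
    { toFun := φ t
      invFun := φ (-t)
      left_inv := hφ.neg_apply_apply t
      right_inv := hφ.apply_neg_apply t
      measurable_toFun := hφ.measurable t
      measurable_invFun := hφ.measurable (-t) }
    (hφ.quasiMeasurePreserving t) (hφ.quasiMeasurePreserving (-t)) hf

/-- The chain rule for Radon-Nikodym derivatives: the densities form a multiplicative cocycle. -/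
theorem maharamDensity_add [AddGroup G] [SigmaFinite μ] (hφ : IsNonsingularAction φ μ) (t u : G) :
    ∀ᵐ s ∂μ, maharamDensity (φ (t + u)) μ s =
      maharamDensity (φ t) μ (φ u s) * maharamDensity (φ u) μ s := by
  have hm (r : G) : Measurable fun s => ENNReal.ofReal (maharamDensity (φ r) μ s : ℝ)⁻¹ :=
    (measurable_maharamDensity (φ r) μ).subtype_val.inv.ennreal_ofReal
  have key : (fun s => ENNReal.ofReal (maharamDensity (φ (t + u)) μ s : ℝ)⁻¹) =ᵐ[μ]
      fun s => ENNReal.ofReal (maharamDensity (φ u) μ s : ℝ)⁻¹ *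
        ENNReal.ofReal (maharamDensity (φ t) μ (φ u s) : ℝ)⁻¹ := by
    refine ae_eq_of_forall_setLIntegral_eq_of_sigmaFinite (hm _)
      ((hm u).mul ((hm t).comp (hφ.measurable u))) fun A hA _ => ?_
    -- Both integrals over `A` are equal to `μ (φ (t + u) '' A)`, written as `∫ F`.
    set F : S → ℝ≥0∞ := (φ (-(t + u)) ⁻¹' A).indicator 1
    have hF : Measurable F := measurable_one.indicator (hφ.measurable _ hA)
    have hFA (s : S) : F (φ (t + u) s) = A.indicator 1 s := by
      have h : φ (t + u) s ∈ φ (-(t + u)) ⁻¹' A ↔ s ∈ A := by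
        rw [mem_preimage, hφ.neg_apply_apply]
      by_cases hs : s ∈ A <;> simp only [F]
      · rw [indicator_of_mem (h.2 hs), indicator_of_mem hs, Pi.one_apply, Pi.one_apply]
      · rw [indicator_of_notMem (mt h.1 hs), indicator_of_notMem hs]
    have e1 := hφ.lintegral_comp_mul (t + u) hF
    have e2 := (hφ.lintegral_comp_mul u ((hm t).mul (hF.comp (hφ.measurable t)))).trans
      (hφ.lintegral_comp_mul t hF)
    rw [← lintegral_indicator hA, ← lintegral_indicator hA]
    convert e1.trans e2.symm using 3 with s s
    · rw [hFA]; by_cases h : s ∈ A <;> simp [h]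
    · simp only [Pi.mul_apply, Function.comp_apply]
      rw [← hφ.add_apply, hFA]; by_cases h : s ∈ A <;> simp [h]
  filter_upwards [key] with s hs
  rw [← ENNReal.ofReal_mul (inv_pos.2 (maharamDensity (φ u) μ s).2).le,
    ENNReal.ofReal_eq_ofReal_iff (inv_pos.2 (maharamDensity (φ (t + u)) μ s).2).le
      (mul_pos (inv_pos.2 (maharamDensity (φ u) μ s).2)
        (inv_pos.2 (maharamDensity (φ t) μ (φ u s)).2)).le, ← mul_inv_rev, inv_inj] at hs
  exact Subtype.ext hs

/-! ### The skew product preserves `μ × Leb` -/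

theorem measurable_maharamSkewProduct [AddGroup G] (hφ : IsNonsingularAction φ μ) (t : G) :
    Measurable (maharamSkewProduct φ μ t) :=
  ((hφ.measurable t).comp measurable_fst).prodMk
    (measurable_mul_pos measurable_snd ((measurable_maharamDensity _ _).comp measurable_fst))

/-- The factor by which the skew product scales the fibre `(0, ∞)` compensates for the distortion of
`μ` by `φ t`. -/
theorem measurePreserving_maharamSkewProduct [AddGroup G] [SigmaFinite μ]
    (hφ : IsNonsingularAction φ μ) (t : G) :
    MeasurePreserving (maharamSkewProduct φ μ t) (μ.prod lebesguePos) (μ.prod lebesguePos) := by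
  refine ⟨hφ.measurable_maharamSkewProduct t, Measure.ext fun E hE => ?_⟩
  rw [Measure.map_apply (hφ.measurable_maharamSkewProduct t) hE,
    Measure.prod_apply (hφ.measurable_maharamSkewProduct t hE), Measure.prod_apply hE,
    ← hφ.lintegral_comp_mul t (measurable_measure_prodMk_left hE)]
  exact lintegral_congr fun s => lebesguePos_preimage_mul_right (maharamDensity (φ t) μ s)
    (Prod.mk (φ t s) ⁻¹' E)

theorem maharamSkewProduct_neg_apply [AddGroup G] [SigmaFinite μ] (hφ : IsNonsingularAction φ μ)
    (t : G) : ∀ᵐ p ∂μ.prod lebesguePos,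
      maharamSkewProduct φ μ (-t) (maharamSkewProduct φ μ t p) = p := by
  have h0 : ∀ᵐ s ∂μ, maharamDensity (φ (-t)) μ (φ t s) * maharamDensity (φ t) μ s = 1 := by
    filter_upwards [hφ.maharamDensity_add (-t) t, hφ.maharamDensity_add 0 0] with s h1 h2
    rw [add_zero, hφ.zero_apply, left_eq_mul] at h2
    rw [← h1, neg_add_cancel, h2]
  filter_upwards [Measure.quasiMeasurePreserving_fst.ae h0] with p hp
  refine Prod.ext (hφ.neg_apply_apply t p.1) ?_
  simp only [maharamSkewProduct]
  rw [mul_assoc, mul_comm (maharamDensity (φ t) μ p.1), hp, mul_one]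

/-- Almost every point of a wandering set of the skew product visits a set of finite measure only
finitely often: the number of visits to `F`, integrated over
`W`, is `∑ t, ν (W ∩ φ*_t⁻¹ F) = ∑ t, ν (φ*_t W ∩ F) ≤ ν F`. -/
theorem ae_finite_visits_of_isWanderingSet [AddGroup G] [Countable G] [SigmaFinite μ]
    (hφ : IsNonsingularAction φ μ) {W F : Set (S × {y : ℝ // 0 < y})}
    (hW : IsWanderingSet (maharamSkewProduct φ μ) (μ.prod lebesguePos) W) (hF : MeasurableSet F)
    (hFfin : μ.prod lebesguePos F ≠ ∞) :
    ∀ᵐ p ∂μ.prod lebesguePos, p ∈ W → {t | maharamSkewProduct φ μ t p ∈ F}.Finite := by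
  set ν := μ.prod lebesguePos
  set ψ := maharamSkewProduct φ μ
  have hswap (t : G) : ν (W ∩ ψ t ⁻¹' F) = ν (ψ (-t) ⁻¹' W ∩ F) := by
    rw [← (hφ.measurePreserving_maharamSkewProduct t).measure_preimage
      ((hφ.measurable_maharamSkewProduct (-t) hW.1).inter hF).nullMeasurableSet]
    refine measure_congr ?_
    filter_upwards [hφ.maharamSkewProduct_neg_apply t] with p hp
    change (p ∈ W ∩ ψ t ⁻¹' F) = (p ∈ ψ t ⁻¹' (ψ (-t) ⁻¹' W ∩ F))
    simp only [preimage_inter, mem_inter_iff, mem_preimage, ψ, hp]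
  have hsum : ∑' t, ν (W ∩ ψ t ⁻¹' F) ≠ ∞ := by
    refine ne_top_of_le_ne_top hFfin ?_
    calc ∑' t, ν (W ∩ ψ t ⁻¹' F) = ∑' t, ν (ψ (-t) ⁻¹' W ∩ F) := tsum_congr hswap
      _ ≤ ν (⋃ t, ψ (-t) ⁻¹' W ∩ F) := by
        refine tsum_meas_le_meas_iUnion_of_disjoint₀ ν
          (fun t => ((hφ.measurable_maharamSkewProduct (-t) hW.1).inter hF).nullMeasurableSet)
          fun t u htu => ?_
        exact (hW.2 (neg_injective.ne htu)).mono inter_subset_left inter_subset_left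
      _ ≤ ν F := measure_mono (iUnion_subset fun t => inter_subset_right)
  filter_upwards [ae_finite_setOfPred_mem hsum] with p hp hpW
  exact hp.subset fun t ht => ⟨hpW, ht⟩

/-! ### First maxima form a wandering set -/

theorem measurable_orbitWeight [AddGroup G] (hφ : IsNonsingularAction φ μ) {h : S → ℝ}
    (hh : Measurable h) (t : G) : Measurable (orbitWeight φ μ h t) :=
  (hh.comp (hφ.measurable t)).div (measurable_maharamDensity _ _).subtype_val

theorem measurableSet_firstMaximumSet [AddGroup G] [LE G] [Countable G]
    (hφ : IsNonsingularAction φ μ) {h : S → ℝ} (hh : Measurable h) :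
    MeasurableSet (firstMaximumSet φ μ h) := by
  have hm := hφ.measurable_orbitWeight hh
  refine measurableSet_setOfPred.2 <| Measurable.forall fun t => ?_
  exact (measurableSet_setOfPred.1 (measurableSet_le (hm t) (hm 0))).and
    ((measurableSet_setOfPred.1 (measurableSet_eq_fun (hm t) (hm 0))).imp measurable_const)

/-- By the cocycle identity, `φ t s` carries the same weights as `s` up to a shift of time and a
positive factor. -/
theorem ae_mem_firstMaximumSet_iff [AddCommGroup G] [LinearOrder G] [IsOrderedAddMonoid G]
    [Countable G] [SigmaFinite μ] (hφ : IsNonsingularAction φ μ) (h : S → ℝ) :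
    ∀ᵐ s ∂μ, ∀ t, φ t s ∈ firstMaximumSet φ μ h ↔
      ∀ r, orbitWeight φ μ h r s ≤ orbitWeight φ μ h t s ∧
        (orbitWeight φ μ h r s = orbitWeight φ μ h t s → t ≤ r) := by
  have hc : ∀ᵐ s ∂μ, ∀ t u, maharamDensity (φ (t + u)) μ s =
      maharamDensity (φ t) μ (φ u s) * maharamDensity (φ u) μ s :=
    ae_all_iff.2 fun t => ae_all_iff.2 fun u => hφ.maharamDensity_add t u
  filter_upwards [hc] with s hs t
  have hpos : (0 : ℝ) < maharamDensity (φ t) μ s := (maharamDensity (φ t) μ s).2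
  have hshift (r : G) : orbitWeight φ μ h r (φ t s) =
      maharamDensity (φ t) μ s * orbitWeight φ μ h (r + t) s := by
    simp only [orbitWeight]
    rw [hs r t, hφ.add_apply, Positive.val_mul]
    field_simp
  simp only [firstMaximumSet, mem_ofPred_eq, hshift, zero_add, mul_le_mul_iff_right₀ hpos,
    mul_right_inj' hpos.ne']
  refine (Equiv.addRight t).forall_congr fun r => ?_
  simp

theorem isWanderingSet_firstMaximumSet [AddCommGroup G] [LinearOrder G] [IsOrderedAddMonoid G]
    [Countable G] [SigmaFinite μ] (hφ : IsNonsingularAction φ μ) {h : S → ℝ} (hh : Measurable h) :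
    IsWanderingSet φ μ (firstMaximumSet φ μ h) := by
  refine ⟨hφ.measurableSet_firstMaximumSet hh, fun t u htu => ?_⟩
  refine measure_eq_zero_iff_ae_notMem.2 ?_
  filter_upwards [hφ.ae_mem_firstMaximumSet_iff h] with s hs ⟨ht, hu⟩
  have ht := (hs t).1 ht
  have hu := (hs u).1 hu
  have heq := le_antisymm (ht u).1 (hu t).1
  exact htu (le_antisymm ((ht u).2 heq) ((hu t).2 heq.symm))

/-! ### Transfer of conservativity -/

theorem isConservativeAction_maharamSkewProduct [AddCommGroup G] [LinearOrder G]
    [IsOrderedAddMonoid G] [Countable G] [SigmaFinite μ] (hφ : IsNonsingularAction φ μ)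
    (hcons : IsConservativeAction φ μ) :
    IsConservativeAction (maharamSkewProduct φ μ) (μ.prod lebesguePos) := by
  intro W hW
  obtain ⟨g, hgpos, hgm, hgint⟩ := exists_pos_lintegral_lt_of_sigmaFinite μ one_ne_zero
  set h : S → ℝ := fun s => g s
  have hh : Measurable h := hgm.coe_nnreal_real
  -- Conservativity kills the wandering set of first maxima, so almost no orbit meets it.
  have hmiss : ∀ᵐ s ∂μ, ∀ t, φ t s ∉ firstMaximumSet φ μ h :=
    ae_all_iff.2 fun t => (hφ.quasiMeasurePreserving t).ae
      (measure_eq_zero_iff_ae_notMem.1 (hcons _ (hφ.isWanderingSet_firstMaximumSet hh)))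
  have hvisits : ∀ᵐ p ∂μ.prod lebesguePos, ∀ a : ℕ, p ∈ W →
      {t | maharamSkewProduct φ μ t p ∈ {q | (q.2 : ℝ) < a * h q.1}}.Finite := by
    refine ae_all_iff.2 fun a => hφ.ae_finite_visits_of_isWanderingSet hW
      (measurableSet_lt measurable_snd.subtype_val ((hh.comp measurable_fst).const_mul _)) ?_
    rw [prod_lebesguePos_setOf_lt (hh.const_mul _)]
    simp only [ENNReal.ofReal_mul (Nat.cast_nonneg a), ENNReal.ofReal_natCast, h,
      ENNReal.ofReal_coe_nnreal]
    rw [lintegral_const_mul _ hgm.coe_nnreal_ennreal]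
    exact ENNReal.mul_ne_top (ENNReal.natCast_ne_top a) (hgint.trans ENNReal.one_lt_top).ne
  refine measure_eq_zero_iff_ae_notMem.2 ?_
  filter_upwards [hvisits, Measure.quasiMeasurePreserving_fst.ae hmiss,
    Measure.quasiMeasurePreserving_fst.ae (hφ.ae_mem_firstMaximumSet_iff h)]
    with p hp hnot hiff hpW
  have hv0 : 0 < orbitWeight φ μ h 0 p.1 :=
    div_pos (NNReal.coe_pos.2 (hgpos _)) (maharamDensity (φ 0) μ p.1).2
  -- `φ*_t p` lies under the graph of `a * h` exactly when the weight at time `t` exceeds `y / a`.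
  obtain ⟨a, ha⟩ := exists_nat_gt ((p.2 : ℝ) / orbitWeight φ μ h 0 p.1)
  have hfin : {t | orbitWeight φ μ h 0 p.1 ≤ orbitWeight φ μ h t p.1}.Finite := by
    refine (hp a hpW).subset fun t ht => ?_
    have ht : orbitWeight φ μ h 0 p.1 ≤ orbitWeight φ μ h t p.1 := ht
    have hlt : (p.2 : ℝ) < a * orbitWeight φ μ h t p.1 :=
      ((div_lt_iff₀ hv0).1 ha).trans_le (mul_le_mul_of_nonneg_left ht (Nat.cast_nonneg a))
    change (p.2 : ℝ) * (maharamDensity (φ t) μ p.1 : ℝ) < a * h (φ t p.1)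
    rwa [orbitWeight, ← mul_div_assoc, lt_div_iff₀ (maharamDensity (φ t) μ p.1).2] at hlt
  obtain ⟨t, ht⟩ := exists_first_maximum (v := fun t => orbitWeight φ μ h t p.1) hfin
  exact hnot t ((hiff t).2 ht)

theorem isConservativeAction_of_maharamSkewProduct [SigmaFinite μ]
    (hcons : IsConservativeAction (maharamSkewProduct φ μ) (μ.prod lebesguePos)) :
    IsConservativeAction φ μ := by
  intro W hW
  have hcyl : IsWanderingSet (maharamSkewProduct φ μ) (μ.prod lebesguePos) (Prod.fst ⁻¹' W) :=
    ⟨measurable_fst hW.1, fun t u htu =>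
      Measure.quasiMeasurePreserving_fst.preimage_null (hW.2 htu)⟩
  have h0 := hcons _ hcyl
  rw [← prod_univ, Measure.prod_prod, mul_eq_zero] at h0
  exact h0.resolve_right lebesguePos_univ_ne_zero

end IsNonsingularAction

theorem theorem2p1 {d : ℕ} {S : Type*} [MeasurableSpace S] [StandardBorelSpace S]
    (μ : Measure S) [SigmaFinite μ] (φ : (Fin d → ℤ) → S → S)
    (hφ : IsNonsingularAction φ μ) :
    IsConservativeAction (maharamSkewProduct φ μ) (μ.prod lebesguePos) ↔
      IsConservativeAction φ μ := by
  refine ⟨IsNonsingularAction.isConservativeAction_of_maharamSkewProduct, fun hcons => ?_⟩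
  -- The lexicographic order makes `ℤ^d` a linearly ordered group.
  have hφ' : IsNonsingularAction (G := Lex (Fin d → ℤ)) (fun t => φ (ofLex t)) μ :=
    ⟨hφ.zero_apply, hφ.add_apply, hφ.quasiMeasurePreserving⟩
  have : Countable (Lex (Fin d → ℤ)) := inferInstanceAs (Countable (Fin d → ℤ))
  exact hφ'.isConservativeAction_maharamSkewProduct hcons
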